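/- **Lemma 2.1.** Let $0<\gamma\le 1$ and let $u,K:\mathbb{R}^2\to\mathbb{R}$ be of class $C^{2,\gamma}$, i.e. twice continuously differentiable with second derivatives that are Hölder continuous with exponent $\gamma$ on every compact set. Assume that $$\int_{\mathbb{R}^2} e^{2u(x)}\,dx<\infty ,\qquad \int_{\mathbb{R}^2} |K(x)|\,e^{2u(x)}\,dx<\infty ,\qquad \sup_{x_0\in\mathbb{R}^2}\int_{B_1(x_0)} \max\{K(x),0\}\,dx<\infty ,$$ where $B_1(x_0)$ is the open disc of radius $1$ about $x_0$. Then $u,K$ jointly solve the system $$-\Delta u(x)=K(x)e^{2u(x)},\qquad -\Delta K(x)=e^{2u(x)}\qquad (x\in\mathbb{R}^2)$$ if and only if, for every $x\in\mathbb{R}^2$, $$u(x)=u(0)-\frac1{2\pi}\int_{\mathbb{R}^2}\bigl(\ln|x-y|-\ln|y|\bigr)K(y)e^{2u(y)}\,dy ,$$ $$K(x)=K(0)-\frac1{2\pi}\int_{\mathbb{R}^2}\bigl(\ln|x-y|-\ln|y|\bigr)e^{2u(y)}\,dy ,$$ where both integrals converge absolutely. -/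

import Mathlib

open MeasureTheory Set
open scoped NNReal

/-- The Euclidean plane `ℝ²`. -/
abbrev Plane : Type := EuclideanSpace ℝ (Fin 2)

/-- `f ∈ C^{2,γ}(ℝ²)` in the usual local sense: `f` is twice continuously differentiable, and its
second derivative is Hölder continuous with exponent `γ` on every compact set. (No global bounds,
since the solutions in question are unbounded.) -/
def IsC2Holder (γ : ℝ≥0) (f : Plane → ℝ) : Prop :=
  ContDiff ℝ 2 f ∧
    ∀ s : Set Plane, IsCompact s → ∃ C : ℝ≥0, HolderOnWith C γ (iteratedFDeriv ℝ 2 f) s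

/-- `K₊ = max {K, 0}` lies in `L¹(B₁(x₀))`, uniformly with respect to `x₀ ∈ ℝ²`. -/
def PosPartUniformlyLocallyIntegrable (K : Plane → ℝ) : Prop :=
  ∃ C : ℝ, ∀ x₀ : Plane,
    IntegrableOn (fun x => max (K x) 0) (Metric.ball x₀ 1) ∧
      ∫ x in Metric.ball x₀ 1, max (K x) 0 ≤ C

/-- The system `-Δu = K e^{2u}`, `-ΔK = e^{2u}` on `ℝ²`, in the classical sense. -/
def SolvesSystem (u K : Plane → ℝ) : Prop :=
  (∀ x, -(Laplacian.laplacian u x) = K x * Real.exp (2 * u x)) ∧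
    (∀ x, -(Laplacian.laplacian K x) = Real.exp (2 * u x))

/-- `w` is represented by its value at the origin and the density `f`:
`w(x) = w(0) - (1/2π) ∫ (ln|x - y| - ln|y|) f(y) dy` for all `x`, where the integral converges
absolutely. -/
def HasLogRepresentation (w f : Plane → ℝ) : Prop :=
  ∀ x : Plane,
    Integrable (fun y => (Real.log ‖x - y‖ - Real.log ‖y‖) * f y) ∧
      w x = w 0 - 1 / (2 * Real.pi) * ∫ y, (Real.log ‖x - y‖ - Real.log ‖y‖) * f y

/-- The pair of integral equations, for `u` with density `K e^{2u}` and for `K` with density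
`e^{2u}`. -/
def SolvesIntegralEquations (u K : Plane → ℝ) : Prop :=
  HasLogRepresentation u (fun y => K y * Real.exp (2 * u y)) ∧
    HasLogRepresentation K (fun y => Real.exp (2 * u y))

/-! Both directions rest on one mean value formula. With `p = parabolicBump`, the gradient of `p²`
is `-4 p(y) y`, so differentiating the average `∫ u(x + r y) p(y) dy` in `r` and integrating by
parts gives `(r/4) ∫ Δu(x + r y) p(y)² dy`. Integrating over `0 < r < R` and exchanging integrals
yields `∫ u(x + R y) p(y) dy - (π/2) u(x) = (1/4) ∫ Δu(z) logKernel(|z - x|/R) dz`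
(`ContDiff.average_sub_eq_integral_logKernel`).

For the forward direction, take this formula at `x` and at `0` and subtract. As `R → ∞` the kernels'
difference tends to `log|z| - log|z - x|`, and it is dominated by the modulus of that limit
(`abs_logKernel_sub_le`), so the right side converges to the potential. The averages about `x` and
`0` differ by `O(|x|/R)` times an average of `|u|`, so it suffices that averages of `|u|` are
`o(R)`. Since `|u| = 2u₊ - u` and the formula at `0` bounds averages of `u` by `O(log R)`, only `u₊`
needs a hypothesis: `u₊ ≤ e^{2u}` handles `u`, and a covering estimate by unit discs handles `K`.

For the converse, the formula applied to a test function shows that `log` is, up to `2π`, the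
fundamental solution (`integral_log_mul_laplacian`). Fubini then gives the equation weakly, and
continuity gives it pointwise. -/

open Filter Topology

/-! ### The averaging weight -/

/-- The truncated paraboloid `(1 - |y|²)₊`. -/
noncomputable def parabolicBump (y : Plane) : ℝ := max (1 - ‖y‖ ^ 2) 0

lemma continuous_parabolicBump : Continuous parabolicBump := by
  unfold parabolicBump; fun_prop

lemma parabolicBump_nonneg (y : Plane) : 0 ≤ parabolicBump y := le_max_right _ _

lemma parabolicBump_le_one (y : Plane) : parabolicBump y ≤ 1 :=
  max_le (by nlinarith [sq_nonneg ‖y‖]) zero_le_one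

lemma parabolicBump_eq_zero {y : Plane} (hy : 1 ≤ ‖y‖) : parabolicBump y = 0 :=
  max_eq_right (by nlinarith)

lemma hasCompactSupport_parabolicBump : HasCompactSupport parabolicBump := by
  refine HasCompactSupport.intro (isCompact_closedBall (0 : Plane) 1) fun y hy => ?_
  rw [mem_closedBall_zero_iff, not_le] at hy
  exact parabolicBump_eq_zero hy.le

/-- Away from `0` both branches are explicit; at `0` the derivative is the limit of the derivatives
nearby. Squaring removes the corner, so `parabolicBump ^ 2` is `C¹` although `parabolicBump` is not.
-/
lemma hasDerivAt_max_zero_sq (t : ℝ) :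
    HasDerivAt (fun t : ℝ => max t 0 ^ 2) (2 * max t 0) t := by
  have h : ∀ y : ℝ, y ≠ 0 → HasDerivAt (fun t : ℝ => max t 0 ^ 2) (2 * max y 0) y := by
    intro y hy
    rcases lt_or_gt_of_ne hy with h | h
    · rw [max_eq_right h.le, mul_zero]
      refine (hasDerivAt_const y (0 : ℝ)).congr_of_eventuallyEq ?_
      filter_upwards [Iio_mem_nhds h] with z hz
      simp [max_eq_right (le_of_lt (mem_Iio.1 hz))]
    · rw [max_eq_left h.le]
      refine HasDerivAt.congr_of_eventuallyEq (f := fun t : ℝ => t ^ 2) ?_ ?_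
      · simpa using hasDerivAt_pow 2 y
      filter_upwards [Ioi_mem_nhds h] with z hz
      simp [max_eq_left (le_of_lt (mem_Ioi.1 hz))]
  exact hasDerivAt_of_hasDerivAt_of_ne' (x := 0) h (by fun_prop) (by fun_prop) t

/-- The reason for choosing this weight: the field `parabolicBump y • y` is a gradient, up to the
factor `-4`. -/
lemma hasFDerivAt_parabolicBump_sq (y : Plane) :
    HasFDerivAt (fun y => parabolicBump y ^ 2) ((-4 * parabolicBump y) • innerSL ℝ y) y := by
  have h1 : HasFDerivAt (fun y : Plane => 1 - ‖y‖ ^ 2) (-(2 • innerSL ℝ y)) y :=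
    ((hasStrictFDerivAt_norm_sq y).hasFDerivAt).const_sub 1
  have h2 := (hasDerivAt_max_zero_sq (1 - ‖y‖ ^ 2)).comp_hasFDerivAt y h1
  refine h2.congr_fderiv ?_
  ext v
  simp [parabolicBump]
  ring

lemma volume_real_unit_ball : volume.real (Metric.ball (0 : Plane) 1) = Real.pi := by
  simp [Measure.real, EuclideanSpace.volume_ball_fin_two, Real.pi_nonneg]

lemma integral_parabolicBump : ∫ y, parabolicBump y = Real.pi / 2 := by
  have h := integral_fun_norm_addHaar (volume : Measure Plane) (fun t => max (1 - t ^ 2) 0)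
  have e : ∫ t in Ioi (0 : ℝ), t * max (1 - t ^ 2) 0 = 1 / 4 := by
    have h1 : ∫ t in Ioi (0 : ℝ), t * max (1 - t ^ 2) 0 =
        ∫ t in Ioc (0 : ℝ) 1, t * max (1 - t ^ 2) 0 := by
      refine (setIntegral_eq_of_subset_of_forall_sdiff_eq_zero measurableSet_Ioi
        Ioc_subset_Ioi_self fun t ht => ?_)
      have : 1 < t := by
        by_contra hc
        exact ht.2 ⟨ht.1, not_lt.1 hc⟩
      rw [max_eq_right (by nlinarith), mul_zero]
    have h2 : ∫ t in Ioc (0 : ℝ) 1, t * max (1 - t ^ 2) 0 =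
        ∫ t in Ioc (0 : ℝ) 1, (t - t ^ 3) := by
      refine setIntegral_congr_fun measurableSet_Ioc fun t ht => ?_
      rw [max_eq_left (by nlinarith [ht.1, ht.2])]
      ring
    rw [h1, h2, ← intervalIntegral.integral_of_le zero_le_one,
      intervalIntegral.integral_sub (by simp) (by simp)]
    norm_num
  have e' : ∫ y, parabolicBump y = ∫ y : Plane, max (1 - ‖y‖ ^ 2) 0 := rfl
  rw [e', h, volume_real_unit_ball]
  simp only [finrank_euclideanSpace, Fintype.card_fin, Nat.add_one_sub_one, pow_one, smul_eq_mul, e,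
    nsmul_eq_mul]
  push_cast
  ring

/-! ### The kernel `logKernel`: monotonicity, domination and limit -/

/-- The regularized logarithmic kernel: it vanishes for `t ≥ 1` and equals
`-log t - 3/4 + t² - t⁴/4` for `0 < t ≤ 1`. -/
noncomputable def logKernel (t : ℝ) : ℝ :=
  -Real.log (min t 1) - 3 / 4 + min t 1 ^ 2 - min t 1 ^ 4 / 4

lemma logKernel_eq_zero {t : ℝ} (ht : 1 ≤ t) : logKernel t = 0 := by
  rw [logKernel, min_eq_right ht]; norm_num

/-- The integrand vanishes for `r ≤ s`. Beyond, expanding the square gives the antiderivative `log r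
+ s²/r² - s⁴/(4r⁴)`, whose value `log s + 3/4` at `r = s` produces the constant in `logKernel`. -/
lemma integral_profile_eq_logKernel {s R : ℝ} (hs : 0 < s) (hR : 0 < R) :
    ∫ r in (0 : ℝ)..R, max (1 - (s / r) ^ 2) 0 ^ 2 / r = logKernel (s / R) := by
  have hzero : ∀ r ∈ Ioc 0 s, max (1 - (s / r) ^ 2) 0 ^ 2 / r = 0 := by
    intro r hr
    have : 1 ≤ s / r := (one_le_div hr.1).2 hr.2
    rw [max_eq_right (by nlinarith)]; simp
  rcases le_total R s with h | h
  · rw [logKernel_eq_zero ((one_le_div hR).2 h), intervalIntegral.integral_of_le hR.le]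
    exact setIntegral_eq_zero_of_forall_eq_zero fun r hr => hzero r ⟨hr.1, hr.2.trans h⟩
  · have h1 : ∫ r in (0 : ℝ)..R, max (1 - (s / r) ^ 2) 0 ^ 2 / r =
        ∫ r in s..R, max (1 - (s / r) ^ 2) 0 ^ 2 / r := by
      rw [intervalIntegral.integral_of_le hR.le, intervalIntegral.integral_of_le h]
      refine setIntegral_eq_of_subset_of_forall_sdiff_eq_zero measurableSet_Ioc
        (Ioc_subset_Ioc_left hs.le) fun r hr => hzero r ⟨hr.1.1, ?_⟩
      by_contra hc
      exact hr.2 ⟨not_le.1 hc, hr.1.2⟩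
    have h2 : ∫ r in s..R, max (1 - (s / r) ^ 2) 0 ^ 2 / r =
        ∫ r in s..R, (1 / r - 2 * s ^ 2 / r ^ 3 + s ^ 4 / r ^ 5) := by
      refine intervalIntegral.integral_congr fun r hr => ?_
      rw [uIcc_of_le h] at hr
      have hr0 : 0 < r := hs.trans_le hr.1
      have : s / r ≤ 1 := (div_le_one hr0).2 hr.1
      have h0 : 0 ≤ s / r := by positivity
      rw [max_eq_left (by nlinarith)]
      field_simp
      ring
    have h3 : ∫ r in s..R, (1 / r - 2 * s ^ 2 / r ^ 3 + s ^ 4 / r ^ 5) =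
        (Real.log R + s ^ 2 / R ^ 2 - s ^ 4 / 4 / R ^ 4) -
          (Real.log s + s ^ 2 / s ^ 2 - s ^ 4 / 4 / s ^ 4) := by
      have hpos : ∀ r ∈ uIcc s R, 0 < r := fun r hr => by
        rw [uIcc_of_le h] at hr
        exact hs.trans_le hr.1
      refine intervalIntegral.integral_eq_sub_of_hasDerivAt
        (f := fun r => Real.log r + s ^ 2 / r ^ 2 - s ^ 4 / 4 / r ^ 4) (fun r hr => ?_) ?_
      · have hr0 := (hpos r hr).ne'
        have d := ((Real.hasDerivAt_log hr0).add
          ((hasDerivAt_const r (s ^ 2)).div (hasDerivAt_pow 2 r) (pow_ne_zero 2 hr0))).sub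
          ((hasDerivAt_const r (s ^ 4 / 4)).div (hasDerivAt_pow 4 r) (pow_ne_zero 4 hr0))
        refine d.congr_deriv ?_
        field_simp
        push_cast
        ring
      · refine ContinuousOn.intervalIntegrable ?_
        have : ∀ r ∈ uIcc s R, r ≠ 0 := fun r hr => (hpos r hr).ne'
        refine ((continuousOn_const.div continuousOn_id this).sub
          (continuousOn_const.div (by fun_prop) fun r hr => pow_ne_zero 3 (this r hr))).add
          (continuousOn_const.div (by fun_prop) fun r hr => pow_ne_zero 5 (this r hr))
    rw [h1, h2, h3, logKernel, min_eq_left ((div_le_one hR).2 h), Real.log_div hs.ne' hR.ne']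
    field_simp
    ring

/-- On `(0, 1]` the derivative is `-(1 - t²)²/t ≤ 0`; composing with `min t 1` extends this to all
`t > 0`. -/
lemma antitoneOn_logKernel : AntitoneOn logKernel (Ioi 0) := by
  have d : ∀ t : ℝ, 0 < t → HasDerivAt (fun t : ℝ => -Real.log t - 3 / 4 + t ^ 2 - t ^ 4 / 4)
      (-((1 - t ^ 2) ^ 2 / t)) t := by
    intro t ht
    refine ((((Real.hasDerivAt_log ht.ne').neg.sub_const (3 / 4)).add
      (hasDerivAt_pow 2 t)).sub ((hasDerivAt_pow 4 t).div_const 4)).congr_deriv ?_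
    field_simp
    push_cast
    ring
  have h : AntitoneOn (fun t : ℝ => -Real.log t - 3 / 4 + t ^ 2 - t ^ 4 / 4) (Ioc 0 1) := by
    refine antitoneOn_of_deriv_nonpos (convex_Ioc 0 1)
      (fun t ht => (d t ht.1).continuousAt.continuousWithinAt) ?_ ?_ <;>
      rw [interior_Ioc] <;> intro t ht
    · exact (d t ht.1).differentiableAt.differentiableWithinAt
    · rw [(d t ht.1).deriv]
      have := ht.1
      exact neg_nonpos.2 (by positivity)
  intro a ha b hb hab
  exact h ⟨lt_min ha one_pos, min_le_right _ _⟩ ⟨lt_min hb one_pos, min_le_right _ _⟩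
    (min_le_min_right 1 hab)

/-- The logarithms combine to `log (max t 1)`, and the remaining polynomial in `min t 1` increases
on `(0, 1]`. -/
lemma monotoneOn_logKernel_add_log :
    MonotoneOn (fun t => logKernel t + Real.log t) (Ioi 0) := by
  have key : ∀ t : ℝ, 0 < t → logKernel t + Real.log t =
      Real.log (max t 1) + (min t 1 ^ 2 - min t 1 ^ 4 / 4 - 3 / 4) := by
    intro t _
    rcases le_total t 1 with h | h
    · simp [logKernel, h]; ring
    · simp [logKernel, h]; ring
  intro a ha b hb hab
  have ha' : 0 < a := ha
  have hb' : 0 < b := hb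
  simp only [key a ha, key b hb]
  have h1 : Real.log (max a 1) ≤ Real.log (max b 1) :=
    Real.log_le_log (by positivity) (max_le_max_right 1 hab)
  have h2 : min a 1 ≤ min b 1 := min_le_min_right 1 hab
  have h3 : 0 < min a 1 := lt_min ha one_pos
  have h4 : min b 1 ≤ 1 := min_le_right _ _
  generalize min a 1 = p at *
  generalize min b 1 = q at *
  have h5 : p ^ 2 ≤ q ^ 2 := by gcongr
  have h6 : q ^ 2 ≤ 1 := by nlinarith
  nlinarith

/-- The two monotonicities trap the drop of `logKernel` between `0` and the rise of `log`. After
scaling by `R` the bound does not depend on `R`, which is what dominated convergence needs. -/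
lemma abs_logKernel_sub_le {a b : ℝ} (ha : 0 < a) (hb : 0 < b) :
    |logKernel a - logKernel b| ≤ |Real.log a - Real.log b| := by
  wlog hab : a ≤ b generalizing a b
  · rw [abs_sub_comm, abs_sub_comm (Real.log a)]
    exact this hb ha (le_of_not_ge hab)
  have h1 := antitoneOn_logKernel ha hb hab
  have h2 := monotoneOn_logKernel_add_log ha hb hab
  have h3 : Real.log a ≤ Real.log b := Real.log_le_log ha hab
  simp only at h2
  rw [abs_of_nonneg (by linarith), abs_sub_comm, abs_of_nonneg (by linarith)]
  linarith

lemma logKernel_nonneg {t : ℝ} (ht : 0 < t) : 0 ≤ logKernel t := by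
  have := antitoneOn_logKernel (mem_Ioi.2 ht) (mem_Ioi.2 (lt_max_of_lt_left ht)) (le_max_left t 1)
  rwa [logKernel_eq_zero (le_max_right t 1)] at this

lemma logKernel_le {t : ℝ} (ht : 0 < t) : logKernel t ≤ max (-Real.log t) 0 := by
  rcases le_total 1 t with h | h
  · rw [logKernel_eq_zero h]; exact le_max_right _ _
  · have := monotoneOn_logKernel_add_log (mem_Ioi.2 ht) (mem_Ioi.2 one_pos) h
    simp only [logKernel_eq_zero le_rfl, Real.log_one] at this
    exact le_max_of_le_left (by linarith)

lemma logKernel_div_le {s R : ℝ} (hs : 0 < s) (hR : 1 ≤ R) :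
    logKernel (s / R) ≤ Real.log R + max (-Real.log s) 0 := by
  have hR0 : 0 < R := one_pos.trans_le hR
  refine (logKernel_le (div_pos hs hR0)).trans ?_
  rw [Real.log_div hs.ne' hR0.ne']
  have := Real.log_nonneg hR
  refine max_le ?_ (add_nonneg this (le_max_right _ _))
  linarith [le_max_left (-Real.log s) 0]

lemma abs_logKernel_div_sub_le {a b R : ℝ} (ha : 0 < a) (hb : 0 < b) (hR : 0 < R) :
    |logKernel (a / R) - logKernel (b / R)| ≤ |Real.log a - Real.log b| := by
  refine (abs_logKernel_sub_le (div_pos ha hR) (div_pos hb hR)).trans_eq ?_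
  rw [Real.log_div ha.ne' hR.ne', Real.log_div hb.ne' hR.ne']
  congr 1
  ring

/-- Once `R ≥ max a b`, the constants and the `log R` terms cancel and the polynomial terms tend to
`0`. -/
lemma tendsto_logKernel_div_sub {a b : ℝ} (ha : 0 < a) (hb : 0 < b) :
    Tendsto (fun R => logKernel (a / R) - logKernel (b / R)) atTop
      (𝓝 (Real.log b - Real.log a)) := by
  have hl : ∀ c : ℝ, Tendsto (fun R : ℝ => c / R) atTop (𝓝 0) := fun c =>
    tendsto_const_nhds.div_atTop tendsto_id
  have h := (((hl a).pow 2).sub ((hl b).pow 2)).sub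
    ((((hl a).pow 4).div_const 4).sub (((hl b).pow 4).div_const 4))
  have h' := h.const_add (Real.log b - Real.log a)
  norm_num at h'
  refine h'.congr' ?_
  filter_upwards [eventually_ge_atTop (max a b)] with R hR
  have hRa : a ≤ R := (le_max_left _ _).trans hR
  have hRb : b ≤ R := (le_max_right _ _).trans hR
  have hR0 : 0 < R := ha.trans_le hRa
  rw [logKernel, logKernel, min_eq_left ((div_le_one hR0).2 hRa),
    min_eq_left ((div_le_one hR0).2 hRb), Real.log_div ha.ne' hR0.ne',
    Real.log_div hb.ne' hR0.ne']
  ring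

/-! ### The Laplacian in coordinates and integration by parts -/

lemma ContDiff.contDiff_one_fderiv_apply {u : Plane → ℝ} (hu : ContDiff ℝ 2 u) (v : Plane) :
    ContDiff ℝ 1 (fun z => fderiv ℝ u z v) :=
  (hu.fderiv_right (m := 1) (by norm_num)).clm_apply contDiff_const

lemma ContDiff.laplacian_eq_sum {u : Plane → ℝ} (hu : ContDiff ℝ 2 u) (x : Plane) :
    Laplacian.laplacian u x = ∑ i, fderiv ℝ (fun z => fderiv ℝ u z (EuclideanSpace.basisFun _ ℝ i))
      x (EuclideanSpace.basisFun (Fin 2) ℝ i) := by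
  rw [InnerProductSpace.laplacian_eq_iteratedFDeriv_orthonormalBasis u
    (EuclideanSpace.basisFun (Fin 2) ℝ)]
  refine Finset.sum_congr rfl fun i _ => ?_
  rw [iteratedFDeriv_two_apply]
  have : DifferentiableAt ℝ (fderiv ℝ u) x :=
    (hu.fderiv_right (m := 1) (by norm_num)).differentiable (by norm_num) x
  rw [fderiv_clm_apply this (differentiableAt_const _)]
  simp

lemma ContDiff.continuous_laplacian {u : Plane → ℝ} (hu : ContDiff ℝ 2 u) :
    Continuous (Laplacian.laplacian u) := by
  have : Laplacian.laplacian u = fun x => ∑ i, fderiv ℝ (fun z => fderiv ℝ u z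
      (EuclideanSpace.basisFun _ ℝ i)) x (EuclideanSpace.basisFun (Fin 2) ℝ i) :=
    funext hu.laplacian_eq_sum
  rw [this]
  refine continuous_finsetSum _ fun i _ => ?_
  exact ((hu.contDiff_one_fderiv_apply _).continuous_fderiv (by norm_num)).clm_apply
    continuous_const

/-- Only first-order regularity is asked of `b`, because `parabolicBump ^ 2`, which later takes its
place, is not `C²`. -/
lemma integral_mul_fderiv_of_hasCompactSupport {a b : Plane → ℝ} (ha : ContDiff ℝ 1 a)
    (hb : Differentiable ℝ b) (hb' : Continuous (fderiv ℝ b)) (hbc : HasCompactSupport b)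
    (v : Plane) : ∫ y, a y * fderiv ℝ b y v = -∫ y, fderiv ℝ a y v * b y := by
  have hb'c : HasCompactSupport (fun y => fderiv ℝ b y v) :=
    (hbc.fderiv ℝ).comp_left (g := fun L : Plane →L[ℝ] ℝ => L v) (by simp)
  have ha' := (ha.continuous_fderiv (by norm_num)).clm_apply (continuous_const (y := v))
  have hb'v := hb'.clm_apply (continuous_const (y := v))
  refine integral_mul_fderiv_eq_neg_fderiv_mul_of_integrable ?_ ?_ ?_
    (fun x _ => ha.differentiable (by norm_num) x) (fun x _ => hb x)
  · exact (ha'.mul hb.continuous).integrable_of_hasCompactSupport hbc.mul_left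
  · exact (ha.continuous.mul hb'v).integrable_of_hasCompactSupport hb'c.mul_left
  · exact (ha.continuous.mul hb.continuous).integrable_of_hasCompactSupport hbc.mul_left

lemma integral_mul_laplacian_comm {u φ : Plane → ℝ} (hu : ContDiff ℝ 2 u) (hφ : ContDiff ℝ 2 φ)
    (hc : HasCompactSupport φ) :
    ∫ x, u x * Laplacian.laplacian φ x = ∫ x, Laplacian.laplacian u x * φ x := by
  have hφ' : Differentiable ℝ φ := hφ.differentiable (by norm_num)
  have hcv : ∀ v, HasCompactSupport (fun y => fderiv ℝ φ y v) := fun v =>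
    (hc.fderiv ℝ).comp_left (g := fun L : Plane →L[ℝ] ℝ => L v) (by simp)
  simp_rw [hu.laplacian_eq_sum, hφ.laplacian_eq_sum, Finset.mul_sum, Finset.sum_mul]
  rw [integral_finsetSum, integral_finsetSum]
  · refine Finset.sum_congr rfl fun i _ => ?_
    set v := EuclideanSpace.basisFun (Fin 2) ℝ i
    have hv := hφ.contDiff_one_fderiv_apply v
    rw [integral_mul_fderiv_of_hasCompactSupport (hu.of_le (by norm_num))
      (hv.differentiable (by norm_num)) (hv.continuous_fderiv (by norm_num)) (hcv v) v,
      integral_mul_fderiv_of_hasCompactSupport (hu.contDiff_one_fderiv_apply v) hφ'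
      (hφ.continuous_fderiv (by norm_num)) hc v, neg_neg]
  · intro i _
    have := ((hu.contDiff_one_fderiv_apply (EuclideanSpace.basisFun (Fin 2) ℝ i)).continuous_fderiv
      (by norm_num)).clm_apply (continuous_const (y := EuclideanSpace.basisFun (Fin 2) ℝ i))
    exact (this.mul hφ.continuous).integrable_of_hasCompactSupport hc.mul_left
  · intro i _
    set v := EuclideanSpace.basisFun (Fin 2) ℝ i
    have h2 : HasCompactSupport (fun x => fderiv ℝ (fun z => fderiv ℝ φ z v) x v) :=
      ((hcv v).fderiv ℝ).comp_left (g := fun L : Plane →L[ℝ] ℝ => L v) (by simp)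
    have := ((hφ.contDiff_one_fderiv_apply v).continuous_fderiv
      (by norm_num)).clm_apply (continuous_const (y := v))
    exact (hu.continuous.mul this).integrable_of_hasCompactSupport h2.mul_left

/-! ### The mean value formula -/

lemma hasCompactSupport_parabolicBump_sq : HasCompactSupport (fun y => parabolicBump y ^ 2) :=
  hasCompactSupport_parabolicBump.comp_left (g := fun t : ℝ => t ^ 2) (by simp)

lemma fderiv_parabolicBump_sq : fderiv ℝ (fun y => parabolicBump y ^ 2) =
    fun y => (-4 * parabolicBump y) • innerSL ℝ y :=
  funext fun y => (hasFDerivAt_parabolicBump_sq y).fderiv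

/-- In each coordinate, `parabolicBump y * y i` is `-1/4` of a partial derivative of `parabolicBump
^ 2`; integrating by parts moves it onto `∂ᵢu(x + r y)`, where the chain rule supplies the factor
`r`. -/
lemma integral_radial_fderiv_mul_parabolicBump {u : Plane → ℝ} (hu : ContDiff ℝ 2 u) (x : Plane)
    (r : ℝ) : ∫ y, fderiv ℝ u (x + r • y) y * parabolicBump y =
      r / 4 * ∫ y, Laplacian.laplacian u (x + r • y) * parabolicBump y ^ 2 := by
  set e := EuclideanSpace.basisFun (Fin 2) ℝ
  have hb' : Continuous (fderiv ℝ (fun y => parabolicBump y ^ 2)) := by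
    rw [fderiv_parabolicBump_sq]
    exact (continuous_const.mul continuous_parabolicBump).smul (innerSL ℝ).continuous
  have haff : ContDiff ℝ 2 (fun y : Plane => x + r • y) := by fun_prop
  have key : ∀ i, ∫ y, fderiv ℝ u (x + r • y) (e i) * (parabolicBump y * y i) =
      r / 4 * ∫ y, fderiv ℝ (fun z => fderiv ℝ u z (e i)) (x + r • y) (e i) *
        parabolicBump y ^ 2 := by
    intro i
    have hui := hu.contDiff_one_fderiv_apply (e i)
    have ha : ContDiff ℝ 1 (fun y => fderiv ℝ u (x + r • y) (e i)) :=
      hui.comp (haff.of_le (by norm_num))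
    have h := integral_mul_fderiv_of_hasCompactSupport ha
      (fun y => (hasFDerivAt_parabolicBump_sq y).differentiableAt) hb'
      hasCompactSupport_parabolicBump_sq (e i)
    have h1 : ∀ y, fderiv ℝ (fun y => parabolicBump y ^ 2) y (e i) =
        -4 * (parabolicBump y * y i) := by
      intro y
      rw [fderiv_parabolicBump_sq]
      simp [e, mul_assoc, EuclideanSpace.inner_single_right]
    have h2 : ∀ y, fderiv ℝ (fun y => fderiv ℝ u (x + r • y) (e i)) y (e i) =
        r * fderiv ℝ (fun z => fderiv ℝ u z (e i)) (x + r • y) (e i) := by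
      intro y
      have d1 : HasFDerivAt (fun y : Plane => x + r • y) (r • ContinuousLinearMap.id ℝ Plane) y :=
        ((hasFDerivAt_id y).const_smul r).const_add x
      have d2 := (hui.differentiable (by norm_num) (x + r • y)).hasFDerivAt
      have d3 := d2.comp y d1
      have : fderiv ℝ (fun y => fderiv ℝ u (x + r • y) (e i)) y = _ := d3.fderiv
      rw [this]
      simp
    simp_rw [h1, h2] at h
    have h3 : ∀ y, fderiv ℝ u (x + r • y) (e i) * (-4 * (parabolicBump y * y i)) =
        -4 * (fderiv ℝ u (x + r • y) (e i) * (parabolicBump y * y i)) := fun y => by ring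
    simp_rw [h3, mul_assoc r] at h
    rw [integral_const_mul, integral_const_mul] at h
    linarith
  have hsum : ∀ y, fderiv ℝ u (x + r • y) y * parabolicBump y =
      ∑ i, fderiv ℝ u (x + r • y) (e i) * (parabolicBump y * y i) := by
    intro y
    have : y = ∑ i, y i • e i := by
      simpa [e] using ((EuclideanSpace.basisFun (Fin 2) ℝ).sum_repr y).symm
    conv_lhs => rw [show fderiv ℝ u (x + r • y) y = fderiv ℝ u (x + r • y) (∑ i, y i • e i) by
      rw [← this]]
    rw [map_sum, Finset.sum_mul]
    refine Finset.sum_congr rfl fun i _ => ?_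
    rw [map_smul, smul_eq_mul]
    ring
  simp_rw [hsum, hu.laplacian_eq_sum, Finset.sum_mul]
  rw [integral_finsetSum, integral_finsetSum, Finset.mul_sum]
  · exact Finset.sum_congr rfl fun i _ => key i
  · intro i _
    have h1 := ((hu.contDiff_one_fderiv_apply (e i)).continuous_fderiv
      (by norm_num)).clm_apply (continuous_const (y := e i))
    have h2 : Continuous (fun y => fderiv ℝ (fun z => fderiv ℝ u z (e i)) (x + r • y) (e i)) :=
      h1.comp haff.continuous
    exact (h2.mul (continuous_parabolicBump.pow 2)).integrable_of_hasCompactSupport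
      hasCompactSupport_parabolicBump_sq.mul_left
  · intro i _
    have h2 : Continuous (fun y => fderiv ℝ u (x + r • y) (e i)) :=
      (hu.contDiff_one_fderiv_apply (e i)).continuous.comp haff.continuous
    exact (h2.mul (continuous_parabolicBump.mul (by fun_prop))).integrable_of_hasCompactSupport
      hasCompactSupport_parabolicBump.mul_right.mul_left

/-- The fundamental theorem of calculus along each ray `r ↦ x + r y`, weighted by `parabolicBump y`
and integrated over `y`; Fubini exchanges the two integrals. -/
lemma integral_parabolicBump_average {u : Plane → ℝ} (hu : ContDiff ℝ 2 u) (x : Plane)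
    (R : ℝ) (hR : 0 ≤ R) : (∫ y, u (x + R • y) * parabolicBump y) - Real.pi / 2 * u x =
      ∫ r in (0 : ℝ)..R, r / 4 * ∫ y, Laplacian.laplacian u (x + r • y) * parabolicBump y ^ 2 := by
  have hu' := hu.continuous_fderiv (by norm_num)
  have hF : Continuous (fun p : ℝ × Plane =>
      fderiv ℝ u (x + p.1 • p.2) p.2 * parabolicBump p.2) :=
    ((hu'.comp (f := fun p : ℝ × Plane => x + p.1 • p.2) (by fun_prop)).clm_apply
      continuous_snd).mul
      (continuous_parabolicBump.comp continuous_snd)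
  have hftc : ∀ y, ∫ r in (0 : ℝ)..R, fderiv ℝ u (x + r • y) y * parabolicBump y =
      u (x + R • y) * parabolicBump y - u x * parabolicBump y := by
    intro y
    rw [intervalIntegral.integral_mul_const, ← sub_mul]
    congr 1
    have hc : Continuous (fun r : ℝ => fderiv ℝ u (x + r • y) y) :=
      (hu'.comp (g := fderiv ℝ u) (f := fun r : ℝ => x + r • y) (by fun_prop)).clm_apply
        continuous_const
    have := intervalIntegral.integral_eq_sub_of_hasDerivAt (a := 0) (b := R)
      (f := fun r : ℝ => u (x + r • y)) (f' := fun r => fderiv ℝ u (x + r • y) y) (fun r _ => ?_)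
      (hc.intervalIntegrable 0 R)
    · simpa using this
    · have d1 : HasDerivAt (fun r : ℝ => x + r • y) y r := by
        simpa using ((hasDerivAt_id r).smul_const y).const_add x
      exact (hu.differentiable (by norm_num) (x + r • y)).hasFDerivAt.comp_hasDerivAt r d1
  have hint : Integrable (Function.uncurry fun (r : ℝ) (y : Plane) =>
      fderiv ℝ u (x + r • y) y * parabolicBump y) ((volume.restrict (uIoc 0 R)).prod volume) := by
    have h1 : IntegrableOn (fun p : ℝ × Plane =>
        fderiv ℝ u (x + p.1 • p.2) p.2 * parabolicBump p.2)
        (Icc 0 R ×ˢ Metric.closedBall 0 1) (volume.prod volume) :=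
      hF.continuousOn.integrableOn_compact (isCompact_Icc.prod (isCompact_closedBall _ _))
    have h2 : IntegrableOn (fun p : ℝ × Plane =>
        fderiv ℝ u (x + p.1 • p.2) p.2 * parabolicBump p.2)
        (Ioc 0 R ×ˢ univ) (volume.prod volume) := by
      refine h1.of_forall_sdiff_eq_zero (measurableSet_Ioc.prod MeasurableSet.univ) fun p hp => ?_
      have : 1 ≤ ‖p.2‖ := by
        by_contra hc
        exact hp.2 ⟨⟨hp.1.1.1.le, hp.1.1.2⟩, mem_closedBall_zero_iff.2 (not_le.1 hc).le⟩
      rw [parabolicBump_eq_zero this, mul_zero]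
    rw [IntegrableOn, ← Measure.prod_restrict, Measure.restrict_univ] at h2
    rwa [uIoc_of_le hR]
  simp_rw [← integral_radial_fderiv_mul_parabolicBump hu x]
  rw [intervalIntegral_integral_swap hint]
  simp_rw [hftc]
  rw [integral_sub, integral_const_mul, integral_parabolicBump, mul_comm (u x)]
  · exact ((hu.continuous.comp (by fun_prop)).mul
      continuous_parabolicBump).integrable_of_hasCompactSupport
        hasCompactSupport_parabolicBump.mul_left
  · exact (continuous_const.mul
      continuous_parabolicBump).integrable_of_hasCompactSupport
        hasCompactSupport_parabolicBump.mul_left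

lemma integral_comp_affine (g : Plane → ℝ) (x : Plane) (r : ℝ) :
    ∫ y, g (x + r • y) = (r ^ 2)⁻¹ * ∫ z, g z := by
  rw [Measure.integral_comp_smul volume (fun z => g (x + z)) r, integral_add_left_eq_self]
  simp

lemma integral_mul_parabolicBump_rescale (g : Plane → ℝ) (x : Plane) {r : ℝ} (hr : r ≠ 0) :
    ∫ y, g (x + r • y) * parabolicBump y =
      (r ^ 2)⁻¹ * ∫ z, g z * parabolicBump (r⁻¹ • (z - x)) := by
  rw [← integral_comp_affine _ x]
  simp [smul_smul, inv_mul_cancel₀ hr]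

lemma mul_integral_parabolicBump_sq (g : Plane → ℝ) (x : Plane) {r : ℝ} (hr : 0 < r) :
    r * ∫ y, g (x + r • y) * parabolicBump y ^ 2 =
      ∫ z, g z * (max (1 - (‖z - x‖ / r) ^ 2) 0 ^ 2 / r) := by
  have h := integral_comp_affine (fun z => g z * (max (1 - (‖z - x‖ / r) ^ 2) 0 ^ 2 / r)) x r
  have e : ∀ y : Plane, g (x + r • y) * (max (1 - (‖x + r • y - x‖ / r) ^ 2) 0 ^ 2 / r) =
      r⁻¹ * (g (x + r • y) * parabolicBump y ^ 2) := by
    intro y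
    rw [add_sub_cancel_left, norm_smul, Real.norm_of_nonneg hr.le, mul_div_cancel_left₀ _ hr.ne',
      parabolicBump]
    ring
  simp_rw [e] at h
  rw [integral_const_mul] at h
  have aux : ∀ I J : ℝ, r⁻¹ * I = (r ^ 2)⁻¹ * J → r * I = J := by
    intro I J h
    field_simp at h
    exact h
  exact aux _ _ h

/-- Substituting `z = x + r y` turns the inner integral into one against the profile `(1 - (|z -
x|/r)²)₊² / r`; integrating that in `r` first gives `logKernel`. -/
lemma integrable_logKernel_and_integral_eq {g : Plane → ℝ} (hg : Continuous g) (x : Plane) {R : ℝ}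
    (hR : 0 < R) : Integrable (fun z => g z * logKernel (‖z - x‖ / R)) ∧
      ∫ r in (0 : ℝ)..R, r * ∫ y, g (x + r • y) * parabolicBump y ^ 2 =
        ∫ z, g z * logKernel (‖z - x‖ / R) := by
  set F : ℝ → Plane → ℝ := fun r z => g z * (max (1 - (‖z - x‖ / r) ^ 2) 0 ^ 2 / r) with hF
  have hmeas : Measurable (Function.uncurry F) := by
    have := hg.measurable
    simp only [hF, Function.uncurry_def]
    fun_prop
  have hFz : ∀ r, 0 < r → Integrable (F r) := by
    intro r hr
    refine Continuous.integrable_of_hasCompactSupport (by simp only [hF]; fun_prop) ?_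
    refine HasCompactSupport.intro (isCompact_closedBall x r) fun z hz => ?_
    rw [Metric.mem_closedBall, dist_eq_norm, not_le] at hz
    have : 1 < ‖z - x‖ / r := (one_lt_div hr).2 hz
    simp only [hF]
    rw [max_eq_right (by nlinarith)]
    simp
  obtain ⟨M, hM⟩ := (isCompact_closedBall x R).exists_bound_of_continuousOn hg.continuousOn
  have hP : Integrable (fun y => parabolicBump y ^ 2) :=
    (continuous_parabolicBump.pow 2).integrable_of_hasCompactSupport
      hasCompactSupport_parabolicBump_sq
  have hint : Integrable (Function.uncurry F) ((volume.restrict (uIoc 0 R)).prod volume) := by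
    rw [uIoc_of_le hR.le, integrable_prod_iff hmeas.aestronglyMeasurable]
    refine ⟨(ae_restrict_iff' measurableSet_Ioc).2 (.of_forall fun r hr => hFz r hr.1), ?_⟩
    -- The singular factor `1/r` is harmless: undoing the substitution, the `L¹` norm of `F r`
    -- carries a factor `r ≤ R`.
    refine Integrable.mono' (g := fun _ => R * ∫ y, M * parabolicBump y ^ 2)
      (integrable_const _) hmeas.aestronglyMeasurable.norm.integral_prod_right' ?_
    refine (ae_restrict_iff' measurableSet_Ioc).2 (.of_forall fun r hr => ?_)
    have e : ∫ y, ‖Function.uncurry F (r, y)‖ =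
        r * ∫ y, |g (x + r • y)| * parabolicBump y ^ 2 := by
      rw [mul_integral_parabolicBump_sq (fun z => |g z|) x hr.1]
      refine integral_congr_ae (.of_forall fun z => ?_)
      simp only [Function.uncurry, hF, norm_mul, Real.norm_eq_abs]
      congr 1
      have := hr.1
      rw [abs_of_nonneg (by positivity)]
    rw [e, Real.norm_of_nonneg
      (mul_nonneg hr.1.le (integral_nonneg fun y => by positivity))]
    refine mul_le_mul hr.2 ?_ (integral_nonneg fun y => by positivity) hR.le
    refine integral_mono ?_ (hP.const_mul M) fun y => ?_
    · refine Continuous.integrable_of_hasCompactSupport ?_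
        hasCompactSupport_parabolicBump_sq.mul_left
      have := continuous_parabolicBump
      fun_prop
    · rcases le_or_gt 1 ‖y‖ with hy | hy
      · simp [parabolicBump_eq_zero hy]
      · refine mul_le_mul_of_nonneg_right (hM _ ?_) (sq_nonneg _)
        rw [mem_closedBall_iff_norm, add_sub_cancel_left, norm_smul, Real.norm_of_nonneg hr.1.le]
        nlinarith [hr.1, hr.2]
  have hinner : ∀ᵐ z : Plane, ∫ r in (0 : ℝ)..R, F r z = g z * logKernel (‖z - x‖ / R) := by
    filter_upwards [compl_mem_ae_iff.2 (measure_singleton x)] with z hz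
    rw [intervalIntegral.integral_const_mul, integral_profile_eq_logKernel
      (norm_pos_iff.2 (sub_ne_zero.2 hz)) hR]
  constructor
  · have := hint.integral_prod_right
    rw [uIoc_of_le hR.le] at this
    refine this.congr ?_
    filter_upwards [hinner] with z hz
    rw [← hz, intervalIntegral.integral_of_le hR.le]
    rfl
  · rw [← integral_congr_ae hinner, ← intervalIntegral_integral_swap hint]
    refine intervalIntegral.integral_congr_ae (.of_forall fun r hr => ?_)
    rw [uIoc_of_le hR.le] at hr
    exact mul_integral_parabolicBump_sq g x hr.1

lemma ContDiff.integrable_laplacian_mul_logKernel {u : Plane → ℝ} (hu : ContDiff ℝ 2 u) (x : Plane)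
    {R : ℝ} (hR : 0 < R) :
    Integrable (fun z => Laplacian.laplacian u z * logKernel (‖z - x‖ / R)) :=
  (integrable_logKernel_and_integral_eq hu.continuous_laplacian x hR).1

lemma ContDiff.average_sub_eq_integral_logKernel {u : Plane → ℝ} (hu : ContDiff ℝ 2 u) (x : Plane)
    {R : ℝ} (hR : 0 < R) : (∫ y, u (x + R • y) * parabolicBump y) - Real.pi / 2 * u x =
      1 / 4 * ∫ z, Laplacian.laplacian u z * logKernel (‖z - x‖ / R) := by
  rw [integral_parabolicBump_average hu x R hR.le,
    ← (integrable_logKernel_and_integral_eq hu.continuous_laplacian x hR).2,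
    ← intervalIntegral.integral_const_mul]
  refine intervalIntegral.integral_congr fun r _ => ?_
  ring

/-! ### Bounds and integrability for the logarithmic kernel -/

/-- The negative part of the logarithm. -/
noncomputable def negLog (t : ℝ) : ℝ := max (-Real.log t) 0

lemma negLog_nonneg (t : ℝ) : 0 ≤ negLog t := le_max_right _ _

lemma neg_log_le_negLog (t : ℝ) : -Real.log t ≤ negLog t := le_max_left _ _

lemma negLog_eq_zero {t : ℝ} (ht : 1 ≤ t) : negLog t = 0 :=
  max_eq_right (neg_nonpos.2 (Real.log_nonneg ht))

lemma measurable_negLog : Measurable negLog :=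
  (Real.measurable_log.neg).max measurable_const

lemma log_sub_log_le {a b c : ℝ} (ha : 0 ≤ a) (hc : 0 ≤ c) (h : a ≤ c + b) :
    Real.log a - Real.log b ≤ Real.log (1 + c) + negLog b := by
  have h1 : 0 ≤ Real.log (1 + c) := Real.log_nonneg (by linarith)
  have h2 := neg_log_le_negLog b
  -- At `a = 0` the convention `log 0 = 0` is used, so the estimate needs no exceptional points.
  rcases ha.eq_or_lt with rfl | ha
  · simp only [Real.log_zero]
    linarith
  rcases le_total b 1 with hb1 | hb1
  · have : Real.log a ≤ Real.log (1 + c) := Real.log_le_log ha (by linarith)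
    linarith
  · have : Real.log a ≤ Real.log ((1 + c) * b) := Real.log_le_log ha (by nlinarith)
    rw [Real.log_mul (by positivity) (by positivity)] at this
    linarith [negLog_nonneg b]

lemma abs_log_norm_sub_le (x y : Plane) : |Real.log ‖x - y‖ - Real.log ‖y‖| ≤
    Real.log (1 + ‖x‖) + negLog ‖y‖ + negLog ‖x - y‖ := by
  have h1 := log_sub_log_le (norm_nonneg (x - y)) (norm_nonneg x) (norm_sub_le x y)
  have h2 := log_sub_log_le (norm_nonneg y) (norm_nonneg x)
    (by simpa using norm_sub_le x (x - y))
  have := negLog_nonneg ‖y‖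
  have := negLog_nonneg ‖x - y‖
  rw [abs_le]
  constructor <;> linarith

/-- In polar coordinates the Jacobian `r` turns the integrand into `(-r log r)₊`, continuous on `[0,
1]` and zero beyond. -/
lemma integrable_negLog_norm : Integrable (fun y : Plane => negLog ‖y‖) := by
  rw [integrable_fun_norm_addHaar volume (f := negLog)]
  simp only [finrank_euclideanSpace, Fintype.card_fin, Nat.add_one_sub_one, pow_one, smul_eq_mul]
  have h1 : IntegrableOn (fun y : ℝ => max (-(y * Real.log y)) 0) (Icc 0 1) :=
    (Real.continuous_mul_log.neg.max continuous_const).continuousOn.integrableOn_compact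
      isCompact_Icc
  refine (h1.of_forall_sdiff_eq_zero (s := Icc 0 1) (t := Ioi 0 ∪ Icc 0 1) (by measurability)
    fun y hy => ?_).mono_set subset_union_left |>.congr_fun (fun y hy => ?_) measurableSet_Ioi
  · have hy1 : 1 ≤ y := by
      by_contra hc
      rcases hy with ⟨h | h, h'⟩
      · exact h' ⟨le_of_lt h, (not_le.1 hc).le⟩
      · exact h' h
    rw [max_eq_right]
    have := Real.log_nonneg hy1
    exact neg_nonpos.2 (by positivity)
  · have hy : 0 < y := hy
    simp only [negLog]
    rw [mul_max_of_nonneg _ _ hy.le, mul_zero, mul_neg]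

lemma integrable_negLog_norm_mul {f : Plane → ℝ} (hf : Continuous f) (x : Plane) :
    Integrable (fun y => negLog ‖x - y‖ * f y) := by
  obtain ⟨M, hM⟩ := (isCompact_closedBall x 1).exists_bound_of_continuousOn hf.continuousOn
  refine ((integrable_negLog_norm.comp_sub_left x).mul_const M).mono' ?_ (.of_forall fun y => ?_)
  · exact ((measurable_negLog.comp (by fun_prop)).mul hf.measurable).aestronglyMeasurable
  · rw [norm_mul, Real.norm_of_nonneg (negLog_nonneg _)]
    rcases le_total ‖x - y‖ 1 with h | h
    · exact mul_le_mul_of_nonneg_left (hM y (by rwa [mem_closedBall_iff_norm'])) (negLog_nonneg _)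
    · simp [negLog_eq_zero h]

lemma integrable_log_sub_log_mul {f : Plane → ℝ} (hf : Continuous f) (hfi : Integrable f)
    (x : Plane) : Integrable (fun y => (Real.log ‖x - y‖ - Real.log ‖y‖) * f y) := by
  have h0 : Integrable (fun y => negLog ‖y‖ * f y) := by
    simpa using integrable_negLog_norm_mul hf 0
  refine (((hfi.norm.const_mul (Real.log (1 + ‖x‖))).add h0.norm).add
    (integrable_negLog_norm_mul hf x).norm).mono' ?_ (.of_forall fun y => ?_)
  · have := hf.measurable
    exact Measurable.aestronglyMeasurable (by fun_prop)
  · simp only [Pi.add_apply, norm_mul, Real.norm_of_nonneg (negLog_nonneg _), ← add_mul]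
    exact mul_le_mul_of_nonneg_right (abs_log_norm_sub_le x y) (norm_nonneg _)

/-! ### Moving the centre of an average, and the representation of solutions -/

/-- If `‖b‖ ≥ 2` both bumps vanish. Otherwise `‖a‖ + ‖b‖ ≤ 5` bounds the left side by `5‖a - b‖`,
while the wider bump is at least `3/4`, and `5 ≤ 7 · 3/4`. -/
lemma abs_parabolicBump_sub_le {a b : Plane} (hab : ‖a - b‖ ≤ 1) :
    |parabolicBump a - parabolicBump b| ≤ 7 * ‖a - b‖ * parabolicBump ((4 : ℝ)⁻¹ • b) := by
  have hs := norm_sub_norm_le a b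
  have hs' := norm_sub_norm_le b a
  rw [norm_sub_rev] at hs'
  rcases le_total 2 ‖b‖ with hb | hb
  · rw [parabolicBump_eq_zero (y := a) (by linarith), parabolicBump_eq_zero (y := b) (by linarith)]
    simpa using mul_nonneg (mul_nonneg (by norm_num) (norm_nonneg _)) (parabolicBump_nonneg _)
  · have h1 : 3 / 4 ≤ parabolicBump ((4 : ℝ)⁻¹ • b) := by
      refine le_max_of_le_left ?_
      rw [norm_smul]
      norm_num
      nlinarith [norm_nonneg b]
    have h2 : |parabolicBump a - parabolicBump b| ≤ |‖b‖ ^ 2 - ‖a‖ ^ 2| := by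
      refine (abs_max_sub_max_le_abs _ _ _).trans_eq ?_
      congr 1
      ring
    have h3 : |‖b‖ ^ 2 - ‖a‖ ^ 2| ≤ 5 * ‖a - b‖ := by
      have : ‖b‖ ^ 2 - ‖a‖ ^ 2 = (‖b‖ - ‖a‖) * (‖b‖ + ‖a‖) := by ring
      rw [this, abs_mul, abs_of_nonneg (by positivity : 0 ≤ ‖b‖ + ‖a‖), mul_comm]
      exact mul_le_mul (by linarith) (abs_le.2 ⟨by linarith, by linarith⟩) (abs_nonneg _)
        (by norm_num)
    nlinarith [norm_nonneg (a - b)]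

lemma integrable_mul_parabolicBump {g : Plane → ℝ} (hg : Continuous g) (x : Plane) (r : ℝ) :
    Integrable (fun y => g (x + r • y) * parabolicBump y) :=
  ((hg.comp (by fun_prop)).mul continuous_parabolicBump).integrable_of_hasCompactSupport
    hasCompactSupport_parabolicBump.mul_left

/-- Averages of `u` at scale `R` about `x` and about the origin differ by `O(|x|/R)` times the
average of `|u|` at scale `4R`. -/
lemma abs_average_sub_average_le {u : Plane → ℝ} (hu : Continuous u) (x : Plane) {R : ℝ}
    (hR : 0 < R) (hxR : ‖x‖ ≤ R) :
    |(∫ y, u (x + R • y) * parabolicBump y) - ∫ y, u (0 + R • y) * parabolicBump y| ≤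
      112 * ‖x‖ / R * ∫ y, |u (0 + (4 * R) • y)| * parabolicBump y := by
  have hcs : ∀ (w : Plane) {r : ℝ}, 0 < r → ∀ {g : Plane → ℝ}, Continuous g →
      Integrable fun z => g z * parabolicBump (r⁻¹ • (z - w)) := by
    intro w r hr g hg
    refine (hg.mul (continuous_parabolicBump.comp
      (by fun_prop))).integrable_of_hasCompactSupport ?_
    refine HasCompactSupport.intro (isCompact_closedBall w r) fun z hz => ?_
    rw [mem_closedBall_iff_norm, not_le] at hz
    show g z * parabolicBump (r⁻¹ • (z - w)) = 0
    rw [parabolicBump_eq_zero, mul_zero]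
    rw [norm_smul, norm_inv, Real.norm_of_nonneg hr.le, ← div_eq_inv_mul]
    exact (one_le_div hr).2 hz.le
  have h4 : 0 < 4 * R := by positivity
  rw [integral_mul_parabolicBump_rescale u x hR.ne', integral_mul_parabolicBump_rescale u 0 hR.ne',
    integral_mul_parabolicBump_rescale (fun z => |u z|) 0 h4.ne', ← mul_sub,
    ← integral_sub (hcs x hR hu) (hcs 0 hR hu), abs_mul, abs_of_nonneg (by positivity)]
  have key : |∫ z, (u z * parabolicBump (R⁻¹ • (z - x)) - u z * parabolicBump (R⁻¹ • (z - 0)))| ≤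
      ∫ z, 7 * (‖x‖ / R) * (|u z| * parabolicBump ((4 * R)⁻¹ • (z - 0))) := by
    rw [← Real.norm_eq_abs]
    refine norm_integral_le_of_norm_le ((hcs 0 h4 hu.abs).const_mul _) (.of_forall fun z => ?_)
    have e : ‖R⁻¹ • (z - x) - R⁻¹ • (z - 0)‖ = ‖x‖ / R := by
      rw [← smul_sub, sub_sub_sub_cancel_left, zero_sub, norm_smul, norm_neg, norm_inv,
        Real.norm_of_nonneg hR.le, div_eq_inv_mul]
    have h := abs_parabolicBump_sub_le (a := R⁻¹ • (z - x)) (b := R⁻¹ • (z - 0))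
      (by rw [e]; exact (div_le_one hR).2 hxR)
    rw [e, smul_smul, ← mul_inv] at h
    rw [← mul_sub, norm_mul, Real.norm_eq_abs, Real.norm_eq_abs]
    calc _ ≤ |u z| * (7 * (‖x‖ / R) * parabolicBump ((4 * R)⁻¹ • (z - 0))) := by gcongr
      _ = _ := by ring
  rw [integral_const_mul] at key
  calc _ ≤ (R ^ 2)⁻¹ * (7 * (‖x‖ / R) * ∫ z, |u z| * parabolicBump ((4 * R)⁻¹ • (z - 0))) := by
        gcongr
    -- `112 = 7 · 4²`, the square coming from the area normalisation at scale `4R`.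
    _ = _ := by field_simp; ring

/-- A `C²` function with integrable Laplacian whose positive part has sublinearly growing averages
is represented by the logarithmic potential of its Laplacian. -/
theorem hasLogRepresentation_of_average_posPart {u f : Plane → ℝ} (hu : ContDiff ℝ 2 u)
    (hf : ∀ x, -Laplacian.laplacian u x = f x) (hfi : Integrable f)
    (hpos : Tendsto (fun R : ℝ => R⁻¹ * ∫ y, max (u (0 + R • y)) 0 * parabolicBump y) atTop (𝓝 0)) :
    HasLogRepresentation u f := by
  have hf' : Laplacian.laplacian u = fun x => -f x := funext fun x => by rw [← hf]; ring
  have hfc : Continuous f := by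
    have : f = fun x => -Laplacian.laplacian u x := funext fun x => (hf x).symm
    rw [this]
    exact hu.continuous_laplacian.neg
  have hrep : ∀ (x : Plane) {R : ℝ}, 0 < R →
      (∫ y, u (x + R • y) * parabolicBump y) - Real.pi / 2 * u x =
      -(1 / 4 * ∫ z, logKernel (‖z - x‖ / R) * f z) := by
    intro x R hR
    rw [hu.average_sub_eq_integral_logKernel x hR, hf', ← mul_neg, ← integral_neg]
    simp only [neg_mul, mul_comm]
  have hki : ∀ (x : Plane) {R : ℝ}, 0 < R → Integrable fun z => logKernel (‖z - x‖ / R) * f z := by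
    intro x R hR
    have := (integrable_logKernel_and_integral_eq hfc x hR).1
    simpa only [mul_comm] using this
  have hne : ∀ x : Plane, ∀ᵐ z : Plane, z ≠ x := fun x =>
    compl_mem_ae_iff.2 (measure_singleton x)
  -- logarithmic bound for the averages of `u`
  obtain ⟨C, hC⟩ : ∃ C : ℝ, ∀ R : ℝ, 1 ≤ R →
      |∫ y, u (0 + R • y) * parabolicBump y| ≤ C + C * Real.log R := by
    have h0 : Integrable (fun y => negLog ‖y‖ * f y) := by
      simpa using integrable_negLog_norm_mul hfc 0
    refine ⟨Real.pi / 2 * |u 0| + (∫ z, ‖f z‖) + ∫ z, ‖negLog ‖z‖ * f z‖, fun R hR => ?_⟩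
    have hR0 : 0 < R := one_pos.trans_le hR
    have hlog := Real.log_nonneg hR
    have h1 : |∫ z, logKernel (‖z - 0‖ / R) * f z| ≤
        ∫ z, (Real.log R * ‖f z‖ + ‖negLog ‖z‖ * f z‖) := by
      rw [← Real.norm_eq_abs]
      refine norm_integral_le_of_norm_le ((hfi.norm.const_mul _).add h0.norm) ?_
      filter_upwards [hne 0] with z hz
      have hz' := norm_pos_iff.2 hz
      rw [sub_zero, norm_mul, norm_mul, ← add_mul, Real.norm_of_nonneg (negLog_nonneg _),
        Real.norm_of_nonneg (logKernel_nonneg (div_pos hz' hR0))]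
      exact mul_le_mul_of_nonneg_right (logKernel_div_le hz' hR) (norm_nonneg _)
    rw [integral_add (hfi.norm.const_mul _) h0.norm, integral_const_mul] at h1
    have h2 := hrep 0 hR0
    have e : ∫ y, u (0 + R • y) * parabolicBump y = Real.pi / 2 * u 0 -
      1 / 4 * ∫ z, logKernel (‖z - 0‖ / R) * f z := by linarith
    have h3 : |∫ y, u (0 + R • y) * parabolicBump y| ≤
        Real.pi / 2 * |u 0| + 1 / 4 * |∫ z, logKernel (‖z - 0‖ / R) * f z| := by
      rw [e]
      refine (abs_sub _ _).trans_eq ?_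
      rw [abs_mul, abs_mul, abs_of_nonneg (by positivity : 0 ≤ Real.pi / 2),
        abs_of_nonneg (by norm_num : (0 : ℝ) ≤ 1 / 4)]
    have p1 : 0 ≤ ∫ z, ‖f z‖ := integral_nonneg fun _ => norm_nonneg _
    have p2 : 0 ≤ ∫ z, ‖negLog ‖z‖ * f z‖ := integral_nonneg fun _ => norm_nonneg _
    have p3 : 0 ≤ Real.pi / 2 * |u 0| := by positivity
    nlinarith [mul_nonneg hlog p1, mul_nonneg hlog p2, mul_nonneg hlog p3]
  -- sublinear growth of the averages of `|u|`
  have habs : Tendsto (fun R : ℝ => R⁻¹ * ∫ y, |u (0 + R • y)| * parabolicBump y) atTop (𝓝 0) := by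
    have hlogR : Tendsto (fun R : ℝ => R⁻¹ * (C + C * Real.log R)) atTop (𝓝 0) := by
      have h1 : Tendsto (fun R : ℝ => Real.log R / R) atTop (𝓝 0) :=
        Real.isLittleO_log_id_atTop.tendsto_div_nhds_zero
      have := (tendsto_inv_atTop_zero.mul_const C).add (h1.const_mul C)
      simp only [zero_mul, mul_zero, add_zero] at this
      exact this.congr fun R => by ring
    have hsum := (hpos.const_mul 2).add hlogR
    simp only [mul_zero, add_zero] at hsum
    refine squeeze_zero' ?_ ?_ hsum
    · filter_upwards [eventually_ge_atTop 0] with R hR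
      exact mul_nonneg (inv_nonneg.2 hR) (integral_nonneg fun y =>
        mul_nonneg (abs_nonneg _) (parabolicBump_nonneg y))
    · filter_upwards [eventually_ge_atTop 1] with R hR
      have hR0 : 0 < R := one_pos.trans_le hR
      -- `|t| = 2 max t 0 - t`: control of `u₊` and of the signed average controls `|u|`.
      have e : ∫ y, |u (0 + R • y)| * parabolicBump y =
          2 * (∫ y, max (u (0 + R • y)) 0 * parabolicBump y) -
            ∫ y, u (0 + R • y) * parabolicBump y := by
        rw [← integral_const_mul, ← integral_sub
          ((integrable_mul_parabolicBump (hu.continuous.max continuous_const) 0 R).const_mul 2)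
          (integrable_mul_parabolicBump hu.continuous 0 R)]
        refine integral_congr_ae (.of_forall fun y => ?_)
        simp only
        rw [← mul_assoc, ← sub_mul]
        congr 1
        rcases le_total (u (0 + R • y)) 0 with h | h
        · rw [abs_of_nonpos h, max_eq_right h]; ring
        · rw [abs_of_nonneg h, max_eq_left h]; ring
      have := neg_le_of_abs_le (hC R hR)
      rw [e]
      have hi := inv_nonneg.2 hR0.le
      nlinarith [mul_le_mul_of_nonneg_left this hi]
  intro x
  have hx := integrable_log_sub_log_mul hfc hfi x
  refine ⟨hx, ?_⟩
  have hdiff : Tendsto (fun R : ℝ => (∫ y, u (x + R • y) * parabolicBump y) -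
      ∫ y, u (0 + R • y) * parabolicBump y) atTop (𝓝 0) := by
    have h4 : Tendsto (fun R : ℝ => 4 * R) atTop atTop :=
      tendsto_id.const_mul_atTop (by norm_num)
    -- `448 = 4 · 112`, because `habs` at scale `4R` carries the factor `(4R)⁻¹`.
    have h := (habs.comp h4).const_mul (448 * ‖x‖)
    rw [mul_zero] at h
    refine squeeze_zero_norm' ?_ h
    filter_upwards [eventually_gt_atTop 0, eventually_ge_atTop ‖x‖] with R hR hxR
    refine (abs_average_sub_average_le hu.continuous x hR hxR).trans_eq ?_
    simp only [Function.comp]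
    field_simp
    ring
  have hker : Tendsto (fun R : ℝ => ∫ z, (logKernel (‖z - x‖ / R) - logKernel (‖z - 0‖ / R)) * f z)
      atTop (𝓝 (∫ z, (Real.log ‖z - 0‖ - Real.log ‖z - x‖) * f z)) := by
    refine tendsto_integral_filter_of_dominated_convergence
      (fun z => ‖(Real.log ‖x - z‖ - Real.log ‖z‖) * f z‖) ?_ ?_ hx.norm ?_
    · filter_upwards [eventually_gt_atTop 0] with R hR
      simp_rw [sub_mul]
      exact ((hki x hR).sub (hki 0 hR)).aestronglyMeasurable
    · filter_upwards [eventually_gt_atTop 0] with R hR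
      filter_upwards [hne x, hne 0] with z hzx hz0
      rw [norm_mul, norm_mul, sub_zero, norm_sub_rev x z]
      exact mul_le_mul_of_nonneg_right (abs_logKernel_div_sub_le
        (norm_pos_iff.2 (sub_ne_zero.2 hzx)) (norm_pos_iff.2 hz0) hR) (norm_nonneg _)
    · filter_upwards [hne x, hne 0] with z hzx hz0
      exact (tendsto_logKernel_div_sub (norm_pos_iff.2 (sub_ne_zero.2 hzx))
        (norm_pos_iff.2 (sub_ne_zero.2 hz0))).mul_const _
  have hlim : Tendsto (fun R : ℝ => (∫ y, u (x + R • y) * parabolicBump y) -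
      ∫ y, u (0 + R • y) * parabolicBump y) atTop (𝓝 (Real.pi / 2 * (u x - u 0) -
        1 / 4 * ∫ z, (Real.log ‖z - 0‖ - Real.log ‖z - x‖) * f z)) := by
    refine ((hker.const_mul (1 / 4)).const_sub (Real.pi / 2 * (u x - u 0))).congr' ?_
    filter_upwards [eventually_gt_atTop 0] with R hR
    have h1 := hrep x hR
    have h2 := hrep 0 hR
    simp_rw [sub_mul]
    rw [integral_sub (hki x hR) (hki 0 hR)]
    linarith
  have heq := tendsto_nhds_unique hdiff hlim
  have hflip : ∫ z, (Real.log ‖z - 0‖ - Real.log ‖z - x‖) * f z =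
      -∫ z, (Real.log ‖x - z‖ - Real.log ‖z‖) * f z := by
    rw [← integral_neg]
    refine integral_congr_ae (.of_forall fun z => ?_)
    simp only [sub_zero, norm_sub_rev z x]
    ring
  rw [hflip] at heq
  have := Real.pi_pos
  field_simp
  linarith

/-! ### Growth of the positive parts of `u` and `K` -/

/-- Growth `O(R²)` of the integral over discs makes the averages bounded, which is more than the
required `o(R)`. -/
lemma tendsto_inv_mul_average_posPart {u : Plane → ℝ} (hu : Continuous u) {C : ℝ}
    (hC : ∀ R : ℝ, 1 ≤ R → ∫ z in Metric.ball (0 : Plane) R, max (u z) 0 ≤ C * R ^ 2) :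
    Tendsto (fun R : ℝ => R⁻¹ * ∫ y, max (u (0 + R • y)) 0 * parabolicBump y) atTop (𝓝 0) := by
  have h := tendsto_inv_atTop_zero.mul_const C
  rw [zero_mul] at h
  refine squeeze_zero' ?_ ?_ h
  · filter_upwards [eventually_ge_atTop 0] with R hR
    exact mul_nonneg (inv_nonneg.2 hR) (integral_nonneg fun y =>
      mul_nonneg (le_max_right _ _) (parabolicBump_nonneg y))
  filter_upwards [eventually_ge_atTop 1] with R hR
  have hR0 : 0 < R := one_pos.trans_le hR
  refine mul_le_mul_of_nonneg_left ?_ (inv_nonneg.2 hR0.le)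
  rw [integral_mul_parabolicBump_rescale (fun z => max (u z) 0) 0 hR0.ne', inv_mul_le_iff₀
    (by positivity), mul_comm (R ^ 2)]
  refine le_trans ?_ (hC R hR)
  rw [← integral_indicator measurableSet_ball]
  refine integral_mono_of_nonneg (.of_forall fun z =>
    mul_nonneg (le_max_right _ _) (parabolicBump_nonneg _)) ?_ (.of_forall fun z => ?_)
  · rw [integrable_indicator_iff measurableSet_ball]
    exact ((hu.max continuous_const).continuousOn.integrableOn_compact
      (isCompact_closedBall (0 : Plane) R)).mono_set Metric.ball_subset_closedBall
  · by_cases hz : z ∈ Metric.ball (0 : Plane) R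
    · rw [indicator_of_mem hz]
      exact mul_le_of_le_one_right (le_max_right _ _) (parabolicBump_le_one _)
    · rw [indicator_of_notMem hz]
      rw [mem_ball_zero_iff, not_lt] at hz
      simp only
      rw [parabolicBump_eq_zero, mul_zero]
      rw [sub_zero, norm_smul, norm_inv, Real.norm_of_nonneg hR0.le, ← div_eq_inv_mul]
      exact (one_le_div hR0).2 hz

lemma setIntegral_posPart_le_of_integrable_exp {u : Plane → ℝ} (hu : Continuous u)
    (hexp : Integrable (fun x => Real.exp (2 * u x))) (R : ℝ) (hR : 1 ≤ R) :
    ∫ z in Metric.ball (0 : Plane) R, max (u z) 0 ≤ (∫ x, Real.exp (2 * u x)) * R ^ 2 := by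
  have h1 : ∫ z in Metric.ball (0 : Plane) R, max (u z) 0 ≤
      ∫ z in Metric.ball (0 : Plane) R, Real.exp (2 * u z) := by
    refine setIntegral_mono ?_ hexp.integrableOn fun z => ?_
    · exact ((hu.max continuous_const).continuousOn.integrableOn_compact
        (isCompact_closedBall (0 : Plane) R)).mono_set Metric.ball_subset_closedBall
    · refine max_le ?_ (Real.exp_pos _).le
      rcases le_total (u z) 0 with h | h
      · exact h.trans (Real.exp_pos _).le
      · linarith [Real.add_one_le_exp (2 * u z)]
  have h2 : ∫ z in Metric.ball (0 : Plane) R, Real.exp (2 * u z) ≤ ∫ x, Real.exp (2 * u x) :=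
    setIntegral_le_integral hexp (.of_forall fun x => (Real.exp_pos _).le)
  have h3 : 0 ≤ ∫ x, Real.exp (2 * u x) := integral_nonneg fun x => (Real.exp_pos _).le
  exact (h1.trans h2).trans (le_mul_of_one_le_right h3 (one_le_pow₀ hR))

/-- Integrate the unit-disc masses over centres `x` in the disc of radius `R + 1`. The total is at
most `C π (R + 1)²`, and by Tonelli each `z` with `‖z‖ < R` is counted with weight `π`, since its
whole unit disc consists of admissible centres. Finally `(R + 1)² ≤ 4R²`. -/
lemma PosPartUniformlyLocallyIntegrable.setIntegral_ball_le {K : Plane → ℝ} (hKc : Continuous K)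
    (hK : PosPartUniformlyLocallyIntegrable K) :
    ∃ C : ℝ, ∀ R : ℝ, 1 ≤ R → ∫ z in Metric.ball (0 : Plane) R, max (K z) 0 ≤ C * R ^ 2 := by
  obtain ⟨C, hC⟩ := hK
  have hC0 : 0 ≤ C :=
    (integral_nonneg fun x => le_max_right (K x) 0).trans (hC 0).2
  refine ⟨4 * C, fun R hR => ?_⟩
  have hR0 : 0 ≤ R := zero_le_one.trans hR
  set k : Plane → ENNReal := fun z => ENNReal.ofReal (max (K z) 0) with hk
  have hkm : Measurable k := (hKc.max continuous_const).measurable.ennreal_ofReal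
  set G : Plane → Plane → ENNReal := fun x z => (Metric.ball x 1).indicator k z with hG
  have hGm : Measurable (Function.uncurry G) := by
    have : Function.uncurry G = {p : Plane × Plane | dist p.2 p.1 < 1}.indicator
        (fun p => k p.2) := by
      ext ⟨x, z⟩
      simp [hG, indicator, Function.uncurry]
    rw [this]
    exact (hkm.comp measurable_snd).indicator
      (measurableSet_lt (measurable_snd.dist measurable_fst) measurable_const)
  have hupper : ∫⁻ x in Metric.ball (0 : Plane) (R + 1), ∫⁻ z, G x z ≤
      ENNReal.ofReal C * (ENNReal.ofReal (R + 1) ^ 2 * ENNReal.ofReal Real.pi) := by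
    calc _ ≤ ∫⁻ x in Metric.ball (0 : Plane) (R + 1), ENNReal.ofReal C := by
          refine lintegral_mono fun x => ?_
          simp only [hG]
          rw [lintegral_indicator measurableSet_ball, ← ofReal_integral_eq_lintegral_ofReal
            (hC x).1 (.of_forall fun z => le_max_right _ _)]
          exact ENNReal.ofReal_le_ofReal (hC x).2
      _ = _ := by rw [setLIntegral_const, EuclideanSpace.volume_ball_fin_two]
  have hlower : ENNReal.ofReal Real.pi * ∫⁻ z in Metric.ball (0 : Plane) R, k z ≤
      ∫⁻ x in Metric.ball (0 : Plane) (R + 1), ∫⁻ z, G x z := by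
    rw [lintegral_lintegral_swap hGm.aemeasurable, ← lintegral_const_mul _ hkm]
    refine (lintegral_mono_ae ?_).trans (setLIntegral_le_lintegral (Metric.ball (0 : Plane) R) _)
    refine (ae_restrict_iff' measurableSet_ball).2 (.of_forall fun z hz => ?_)
    rw [mem_ball_zero_iff] at hz
    calc ENNReal.ofReal Real.pi * k z = ∫⁻ x in Metric.ball z 1, G x z := by
          rw [setLIntegral_congr_fun (g := fun _ => k z) measurableSet_ball fun x hx => ?_]
          · rw [setLIntegral_const, EuclideanSpace.volume_ball_fin_two]
            simp [mul_comm]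
          · exact indicator_of_mem (Metric.mem_ball_comm.1 hx) _
      _ ≤ _ := lintegral_mono_set (Metric.ball_subset_ball' (by
          rw [dist_zero_right]; linarith))
  have hint : IntegrableOn (fun z => max (K z) 0) (Metric.ball (0 : Plane) R) :=
    ((hKc.max continuous_const).continuousOn.integrableOn_compact
      (isCompact_closedBall (0 : Plane) R)).mono_set Metric.ball_subset_closedBall
  have h := hlower.trans hupper
  rw [← ofReal_integral_eq_lintegral_ofReal hint (.of_forall fun z => le_max_right _ _),
    ← ENNReal.ofReal_pow (by linarith), ← ENNReal.ofReal_mul (by positivity),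
    ← ENNReal.ofReal_mul (sq_nonneg (R + 1)),
    ← ENNReal.ofReal_mul hC0, ENNReal.ofReal_le_ofReal_iff (by positivity)] at h
  have h' : ∫ z in Metric.ball (0 : Plane) R, max (K z) 0 ≤ C * (R + 1) ^ 2 := by
    refine le_of_mul_le_mul_left ?_ Real.pi_pos
    linarith
  refine h'.trans ?_
  nlinarith [mul_le_mul_of_nonneg_left (by nlinarith : (R + 1) ^ 2 ≤ 4 * R ^ 2) hC0]

/-! ### The fundamental solution and the converse direction -/

lemma hasCompactSupport_laplacian {φ : Plane → ℝ} (hc : HasCompactSupport φ) :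
    HasCompactSupport (Laplacian.laplacian φ) := by
  refine HasCompactSupport.intro hc.isCompact fun x hx => ?_
  have h : φ =ᶠ[𝓝 x] fun _ => (0 : ℝ) := notMem_tsupport_iff_eventuallyEq.1 hx
  have h' := InnerProductSpace.laplacian_congr_nhds h
  rw [h'.eq_of_nhds]
  simp

lemma integral_laplacian_eq_zero {φ : Plane → ℝ} (hφ : ContDiff ℝ 2 φ) (hc : HasCompactSupport φ) :
    ∫ x, Laplacian.laplacian φ x = 0 := by
  simpa using integral_mul_laplacian_comm (u := fun _ => (1 : ℝ)) contDiff_const hφ hc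

lemma abs_log_le {t : ℝ} (ht : 0 ≤ t) : |Real.log t| ≤ negLog t + Real.log (1 + t) := by
  have h1 : 0 ≤ Real.log (1 + t) := Real.log_nonneg (by linarith)
  have h2 := neg_log_le_negLog t
  have h3 := negLog_nonneg t
  have h4 : Real.log t ≤ Real.log (1 + t) := by
    rcases ht.eq_or_lt with rfl | ht
    · simp
    · exact Real.log_le_log ht (by linarith)
  rw [abs_le]
  constructor <;> linarith

lemma integrable_log_norm_sub_mul {g : Plane → ℝ} (hg : Continuous g) (hc : HasCompactSupport g)
    (y : Plane) : Integrable (fun z => Real.log ‖y - z‖ * g z) := by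
  have h2 : Integrable (fun z => Real.log (1 + ‖y - z‖) * g z) := by
    refine Continuous.integrable_of_hasCompactSupport ?_ hc.mul_left
    exact (Continuous.log (by fun_prop) fun z => by positivity).mul hg
  refine ((integrable_negLog_norm_mul hg y).norm.add h2.norm).mono' ?_ (.of_forall fun z => ?_)
  · have := hg.measurable
    exact Measurable.aestronglyMeasurable (by fun_prop)
  · simp only [Pi.add_apply, norm_mul, ← add_mul]
    refine mul_le_mul_of_nonneg_right ?_ (norm_nonneg _)
    rw [Real.norm_of_nonneg (negLog_nonneg _), Real.norm_eq_abs, Real.norm_of_nonneg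
      (Real.log_nonneg (by linarith [norm_nonneg (y - z)] : 1 ≤ 1 + ‖y - z‖))]
    exact abs_log_le (norm_nonneg _)

/-- `(1/2π) log |·|` is the fundamental solution of the Laplacian. -/
lemma integral_log_mul_laplacian {φ : Plane → ℝ} (hφ : ContDiff ℝ 2 φ) (hc : HasCompactSupport φ)
    (y : Plane) : ∫ z, Real.log ‖y - z‖ * Laplacian.laplacian φ z = 2 * Real.pi * φ y := by
  have hΔ := hφ.continuous_laplacian
  have hΔc := hasCompactSupport_laplacian hc
  have hφi : Integrable φ := hφ.continuous.integrable_of_hasCompactSupport hc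
  have hΔi : Integrable (Laplacian.laplacian φ) := hΔ.integrable_of_hasCompactSupport hΔc
  have havg : Tendsto (fun R : ℝ => ∫ z, φ (y + R • z) * parabolicBump z) atTop (𝓝 0) := by
    have h : Tendsto (fun R : ℝ => (R ^ 2)⁻¹ * ∫ z, ‖φ z‖) atTop (𝓝 0) := by
      have := (tendsto_inv_atTop_zero.comp (tendsto_pow_atTop (α := ℝ) two_ne_zero)).mul_const
        (∫ z, ‖φ z‖)
      simpa using this
    refine squeeze_zero_norm' ?_ h
    filter_upwards [eventually_gt_atTop 0] with R hR
    rw [integral_mul_parabolicBump_rescale φ y hR.ne', norm_mul, Real.norm_of_nonneg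
      (by positivity : 0 ≤ (R ^ 2)⁻¹)]
    refine mul_le_mul_of_nonneg_left ?_ (by positivity)
    refine norm_integral_le_of_norm_le hφi.norm (.of_forall fun z => ?_)
    rw [norm_mul, Real.norm_of_nonneg (parabolicBump_nonneg _)]
    exact mul_le_of_le_one_right (norm_nonneg _) (parabolicBump_le_one _)
  have hne : ∀ᵐ z : Plane, z ≠ y := compl_mem_ae_iff.2 (measure_singleton y)
  -- `logKernel (‖z - y‖ / R)` alone diverges like `log R`. Subtracting the constant `logKernel (1 /
  -- R)` restores convergence and costs nothing, since `Δφ` has integral zero.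
  have hker : Tendsto (fun R : ℝ => ∫ z, (logKernel (‖z - y‖ / R) - logKernel (1 / R)) *
      Laplacian.laplacian φ z) atTop
      (𝓝 (∫ z, (Real.log 1 - Real.log ‖z - y‖) * Laplacian.laplacian φ z)) := by
    refine tendsto_integral_filter_of_dominated_convergence
      (fun z => ‖Real.log ‖y - z‖ * Laplacian.laplacian φ z‖) ?_ ?_
      (integrable_log_norm_sub_mul hΔ hΔc y).norm ?_
    · filter_upwards [eventually_gt_atTop 0] with R hR
      simp_rw [sub_mul, mul_comm _ (Laplacian.laplacian φ _)]
      exact ((hφ.integrable_laplacian_mul_logKernel y hR).sub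
        (hΔi.mul_const _)).aestronglyMeasurable
    · filter_upwards [eventually_gt_atTop 0] with R hR
      filter_upwards [hne] with z hz
      rw [norm_mul, norm_mul, norm_sub_rev y z]
      have := abs_logKernel_div_sub_le (norm_pos_iff.2 (sub_ne_zero.2 hz)) one_pos hR
      rw [Real.log_one, sub_zero] at this
      exact mul_le_mul_of_nonneg_right this (norm_nonneg _)
    · filter_upwards [hne] with z hz
      exact (tendsto_logKernel_div_sub (norm_pos_iff.2 (sub_ne_zero.2 hz)) one_pos).mul_const _
  have hlim : Tendsto (fun R : ℝ => ∫ z, φ (y + R • z) * parabolicBump z) atTop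
      (𝓝 (1 / 4 * (∫ z, (Real.log 1 - Real.log ‖z - y‖) * Laplacian.laplacian φ z) +
        Real.pi / 2 * φ y)) := by
    refine ((hker.const_mul (1 / 4)).add_const (Real.pi / 2 * φ y)).congr' ?_
    filter_upwards [eventually_gt_atTop 0] with R hR
    have h := hφ.average_sub_eq_integral_logKernel y hR
    simp_rw [sub_mul, mul_comm _ (Laplacian.laplacian φ _)]
    rw [integral_sub (hφ.integrable_laplacian_mul_logKernel y hR) (hΔi.mul_const _),
      integral_mul_const, integral_laplacian_eq_zero hφ hc]
    linarith
  have heq := tendsto_nhds_unique havg hlim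
  have hflip : ∫ z, (Real.log 1 - Real.log ‖z - y‖) * Laplacian.laplacian φ z =
      -∫ z, Real.log ‖y - z‖ * Laplacian.laplacian φ z := by
    rw [← integral_neg]
    refine integral_congr_ae (.of_forall fun z => ?_)
    simp only [Real.log_one, norm_sub_rev z y]
    ring
  rw [hflip] at heq
  linarith

/-- Each of the three terms bounding the kernel gives an integrable majorant: two are products of a
function of `x` and a function of `y`, the third is a convolution integrand once `Δφ` is bounded by
`M`. -/
lemma integrable_prod_laplacian_mul_log {φ f : Plane → ℝ} (hφ : ContDiff ℝ 2 φ)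
    (hc : HasCompactSupport φ) (hf : Continuous f) (hfi : Integrable f) :
    Integrable (Function.uncurry fun x y => Laplacian.laplacian φ x *
      ((Real.log ‖x - y‖ - Real.log ‖y‖) * f y)) (volume.prod volume) := by
  have hΔ := hφ.continuous_laplacian
  have hΔc := hasCompactSupport_laplacian hc
  have hΔi : Integrable (Laplacian.laplacian φ) := hΔ.integrable_of_hasCompactSupport hΔc
  obtain ⟨M, hM⟩ := hΔc.exists_bound_of_continuous hΔ
  have h1 : Integrable (fun x => Real.log (1 + ‖x‖) * Laplacian.laplacian φ x) := by
    refine Continuous.integrable_of_hasCompactSupport ?_ hΔc.mul_left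
    exact (Continuous.log (by fun_prop) fun z => by positivity).mul hΔ
  have h2 : Integrable (fun y => negLog ‖y‖ * f y) := by
    simpa using integrable_negLog_norm_mul hf 0
  have h3 := (hfi.convolution_integrand (ContinuousLinearMap.mul ℝ ℝ) integrable_negLog_norm
    (μ := volume)).norm.const_mul M
  refine (((h1.norm.mul_prod hfi.norm).add (hΔi.norm.mul_prod h2.norm)).add h3).mono' ?_
    (.of_forall fun p => ?_)
  · have := hf.measurable
    have := hΔ.measurable
    exact Measurable.aestronglyMeasurable (by unfold Function.uncurry; fun_prop)
  · simp only [Function.uncurry, Pi.add_apply, norm_mul, ContinuousLinearMap.mul_apply',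
      Real.norm_of_nonneg (negLog_nonneg _), Real.norm_of_nonneg
      (Real.log_nonneg (by linarith [norm_nonneg p.1] : 1 ≤ 1 + ‖p.1‖))]
    have hb := abs_log_norm_sub_le p.1 p.2
    have hn := negLog_nonneg ‖p.1 - p.2‖
    calc _ ≤ ‖Laplacian.laplacian φ p.1‖ *
          ((Real.log (1 + ‖p.1‖) + negLog ‖p.2‖ + negLog ‖p.1 - p.2‖) * ‖f p.2‖) := by
          gcongr
          exact hb
      _ = Real.log (1 + ‖p.1‖) * ‖Laplacian.laplacian φ p.1‖ * ‖f p.2‖ +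
          ‖Laplacian.laplacian φ p.1‖ * (negLog ‖p.2‖ * ‖f p.2‖) +
          ‖Laplacian.laplacian φ p.1‖ * (‖f p.2‖ * negLog ‖p.1 - p.2‖) := by ring
      _ ≤ _ := by
          gcongr
          exact hM p.1

/-- A `C²` logarithmic potential solves the Poisson equation. -/
theorem HasLogRepresentation.neg_laplacian_eq {w f : Plane → ℝ} (h : HasLogRepresentation w f)
    (hw : ContDiff ℝ 2 w) (hf : Continuous f) (hfi : Integrable f) (x : Plane) :
    -Laplacian.laplacian w x = f x := by
  have hcont : Continuous (fun x => Laplacian.laplacian w x + f x) :=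
    hw.continuous_laplacian.add hf
  have hzero : ∀ᵐ x : Plane, Laplacian.laplacian w x + f x = 0 := by
    refine ae_eq_zero_of_integral_contDiff_smul_eq_zero hcont.locallyIntegrable
      fun φ hφ hc => ?_
    have hφ2 : ContDiff ℝ 2 φ := hφ.of_le (WithTop.coe_le_coe.2 le_top)
    have hΔ := hφ2.continuous_laplacian
    have hΔc := hasCompactSupport_laplacian hc
    have hΔi : Integrable (Laplacian.laplacian φ) := hΔ.integrable_of_hasCompactSupport hΔc
    have hw1 : ∫ x, w x * Laplacian.laplacian φ x = -(1 / (2 * Real.pi)) *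
        ∫ x, ∫ y, Laplacian.laplacian φ x * ((Real.log ‖x - y‖ - Real.log ‖y‖) * f y) := by
      have e : ∀ x, w x * Laplacian.laplacian φ x = w 0 * Laplacian.laplacian φ x +
          -(1 / (2 * Real.pi)) * ∫ y, Laplacian.laplacian φ x *
            ((Real.log ‖x - y‖ - Real.log ‖y‖) * f y) := by
        intro x
        rw [(h x).2, integral_const_mul]
        ring
      simp_rw [e]
      rw [integral_add (hΔi.const_mul _)
        (Integrable.const_mul (f := fun x => ∫ y, Laplacian.laplacian φ x *
          ((Real.log ‖x - y‖ - Real.log ‖y‖) * f y))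
          (integrable_prod_laplacian_mul_log hφ2 hc hf hfi).integral_prod_left _),
        integral_const_mul, integral_laplacian_eq_zero hφ2 hc, integral_const_mul]
      ring
    rw [integral_integral_swap (integrable_prod_laplacian_mul_log hφ2 hc hf hfi)] at hw1
    -- The `log ‖y‖` term drops out because `Δφ` has integral zero.
    have hinner : ∀ y, ∫ x, Laplacian.laplacian φ x * ((Real.log ‖x - y‖ - Real.log ‖y‖) * f y) =
        2 * Real.pi * (φ y * f y) := by
      intro y
      have e : ∀ x, Laplacian.laplacian φ x * ((Real.log ‖x - y‖ - Real.log ‖y‖) * f y) =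
          (Real.log ‖y - x‖ * Laplacian.laplacian φ x - Real.log ‖y‖ * Laplacian.laplacian φ x) *
            f y := by
        intro x
        rw [norm_sub_rev x y]
        ring
      simp_rw [e]
      rw [integral_mul_const, integral_sub (integrable_log_norm_sub_mul hΔ hΔc y)
        (hΔi.const_mul _), integral_const_mul, integral_laplacian_eq_zero hφ2 hc,
        integral_log_mul_laplacian hφ2 hc]
      ring
    simp_rw [hinner] at hw1
    rw [integral_const_mul, integral_mul_laplacian_comm hw hφ2 hc] at hw1
    have hpi := Real.pi_pos
    have hw2 : ∫ x, Laplacian.laplacian w x * φ x = -∫ x, φ x * f x := by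
      rw [hw1]
      field_simp
    simp only [smul_eq_mul, mul_add]
    rw [integral_add]
    · simp_rw [mul_comm (φ _) (Laplacian.laplacian w _), hw2]
      ring
    · exact (hφ.continuous.mul hw.continuous_laplacian).integrable_of_hasCompactSupport hc.mul_right
    · exact (hφ.continuous.mul hf).integrable_of_hasCompactSupport hc.mul_right
  -- Continuity of `Δw + f` upgrades vanishing almost everywhere to vanishing everywhere.
  have := congrFun ((Continuous.ae_eq_iff_eq volume hcont continuous_const).1 hzero) x
  linarith

theorem lemma2p1 (γ : ℝ≥0) (hγ_pos : 0 < γ) (hγ_le : γ ≤ 1) (u K : Plane → ℝ)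
    (hu : IsC2Holder γ u) (hK : IsC2Holder γ K)
    (harea : Integrable (fun x => Real.exp (2 * u x)))
    (hcurv : Integrable (fun x => K x * Real.exp (2 * u x)))
    (hKpos : PosPartUniformlyLocallyIntegrable K) :
    SolvesSystem u K ↔ SolvesIntegralEquations u K := by
  have huc := hu.1.continuous
  have hKc := hK.1.continuous
  constructor
  · rintro ⟨h1, h2⟩
    obtain ⟨C, hC⟩ := hKpos.setIntegral_ball_le hKc
    exact ⟨hasLogRepresentation_of_average_posPart hu.1 h1 hcurv
        (tendsto_inv_mul_average_posPart huc (setIntegral_posPart_le_of_integrable_exp huc harea)),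
      hasLogRepresentation_of_average_posPart hK.1 h2 harea
        (tendsto_inv_mul_average_posPart hKc hC)⟩
  · rintro ⟨h1, h2⟩
    exact ⟨h1.neg_laplacian_eq hu.1 (by fun_prop) hcurv,
      h2.neg_laplacian_eq hK.1 (by fun_prop) harea⟩
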